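/- There is a universal constant $C>0$ such that the following holds. Let $\mathbf M=(E,\mathcal I)$ be a matroid on a finite set $E$ with $m=|E|\ge 1$ and rank function $r$. Let $\tilde c=(\tilde c_e)_{e\in E}$ be independent random variables, where $\tilde c_e$ takes values in $\{c_e^-,c_e^-+1,\dots,c_e^+\}$ with $c_e^-,c_e^+\in\mathbb Z_{\ge 0}$, and let $p\in(0,1]$ be such that $\Pr(\tilde c_e=c_e^+)\ge p$ for all $e\in E$. Put $\Delta_c=\max_{e\in E}(c_e^+-c_e^-)$ and let $0<\varepsilon<1$. Consider the following adaptive strategy with $T$ iterations; it knows $\mathbf M$ and the numbers $c_e^\pm$, but learns the realized value $c_e$ of $\tilde c_e$ only by querying $e$. In each iteration, let $\overline c_e=c_e$ if $e$ has been queried before and $\overline c_e=c_e^+$ otherwise, find an (arbitrary) optimal solution $x$ to the optimistic linear program $$\max\Big\{\sum_{e\in E}\overline c_e x_e \;:\; \sum_{e\in S}x_e\le r(S)\ (S\subseteq E),\ x\in\mathbb R_{\ge 0}^E\Big\},$$ and then query each $e\in E$ independently with probability $x_e$. After the $T$ iterations, let $\underline c_e=c_e$ if $e$ has been queried and $\underline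 c_e=c_e^-$ otherwise, and output a set $I\in\mathcal I$ that maximizes $\sum_{e\in I}\underline c_e$ over $\mathcal I$. The choices of the optimal solutions $x$ and $I$ may be randomized and may depend on all queries made and values revealed so far. If $$T\ \ge\ C\,\frac{\Delta_c\,\log(m/\varepsilon)}{\varepsilon p},$$ then, with probability at least $1-\varepsilon$ over both the realization of $\tilde c$ and the randomness of the strategy, the output $I$ is an independent set that is $(1-\varepsilon)$-approximate for the realized weights: $$\sum_{e\in I}c_e\ \ge\ (1-\varepsilon)\max_{J\in\mathcal I}\sum_{e\in J}c_e .$$ -/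

import Mathlib

open scoped BigOperators ENNReal

noncomputable section

namespace StochasticPacking

/-! ## Independent products of discrete distributions -/

theorem tsum_prod_pmf {E α : Type*} [Fintype E] [Countable α] (D : E → PMF α) :
    ∑' f : E → α, ∏ e, D e (f e) = 1 := by
  classical
  let _ : MeasurableSpace α := ⊤
  have : DiscreteMeasurableSpace α := ⟨fun _ => trivial⟩
  have h1 : ∀ f : E → α,
      (MeasureTheory.Measure.pi fun e => (D e).toMeasure) {f} = ∏ e, D e (f e) := by
    intro f
    rw [MeasureTheory.Measure.pi_singleton]
    exact Finset.prod_congr rfl fun e _ =>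
      PMF.toMeasure_apply_singleton (D e) (f e) (MeasurableSet.singleton _)
  have h2 : (MeasureTheory.Measure.pi fun e => (D e).toMeasure) (Set.univ : Set (E → α)) = 1 :=
    MeasureTheory.measure_univ
  rw [← h2, ← MeasureTheory.Measure.tsum_indicator_apply_singleton _ _ MeasurableSet.univ]
  exact tsum_congr fun f => by rw [Set.indicator_univ, h1 f]

/-- The joint law of independent random variables, the `e`-th of which has law `D e`. -/
def indepLaw {E α : Type*} [Fintype E] [Countable α] (D : E → PMF α) : PMF (E → α) :=
  ⟨fun f => ∏ e, D e (f e), (tsum_prod_pmf D) ▸ ENNReal.summable.hasSum⟩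

/-- A coin that shows `true` with probability `x` (for `x` outside `[0, 1]`, with the nearest
probability in `[0, 1]`). -/
def coin (x : ℝ) : PMF Bool :=
  PMF.ofFintype
    (fun s => cond s (ENNReal.ofReal (max 0 (min 1 x))) (1 - ENNReal.ofReal (max 0 (min 1 x)))) (by
      have h : ENNReal.ofReal (max 0 (min 1 x)) ≤ 1 :=
        ENNReal.ofReal_le_one.2 (max_le zero_le_one (min_le_left _ _))
      simp)

/-! ## Stochastic packing integer programs -/

/-- A packing system `A x ≤ b` with nonnegative integral data; the rows are indexed by `R`, the
variables by `E`. -/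
structure PackingSystem (R E : Type*) where
  /-- the constraint matrix -/
  A : Matrix R E ℕ
  /-- the right-hand side -/
  b : R → ℕ

/-- Integral random weights on `E`, given by their marginal laws (the weights of different
elements are independent, see `jointLaw`): the weight of `e` lies in the integer interval
`{lo e, …, hi e}`. The laws are hidden from the algorithm, the bounds are not. -/
structure StochasticWeight (E : Type*) where
  /-- the lower ends of the domains -/
  lo : E → ℕ
  /-- the upper ends of the domains -/
  hi : E → ℕ
  /-- the hidden distributions -/
  law : E → PMF ℕ
  support_law : ∀ e, (law e).support ⊆ Set.Icc (lo e) (hi e)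

/-- The law of the vector of realized weights: the weights are independent. -/
def StochasticWeight.jointLaw {E : Type*} [Fintype E] (w : StochasticWeight E) : PMF (E → ℕ) :=
  indepLaw w.law

/-- The largest width `max_e (hi e - lo e)` of a domain. -/
def StochasticWeight.width {E : Type*} [Fintype E] (w : StochasticWeight E) : ℕ :=
  Finset.univ.sup fun e => w.hi e - w.lo e

namespace PackingSystem

variable {R E : Type*} [Fintype E]

/-- Feasibility for the LP relaxation: `A x ≤ b` and `x ≥ 0`. -/
def LPFeasible (P : PackingSystem R E) (x : E → ℝ) : Prop :=
  (∀ e, 0 ≤ x e) ∧ ∀ i, ∑ e, (P.A i e : ℝ) * x e ≤ (P.b i : ℝ)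

/-- `x` is an optimal solution to the LP relaxation with objective vector `c`. -/
def LPOptimal (P : PackingSystem R E) (c : E → ℕ) (x : E → ℝ) : Prop :=
  P.LPFeasible x ∧ ∀ x', P.LPFeasible x' → ∑ e, (c e : ℝ) * x' e ≤ ∑ e, (c e : ℝ) * x e

/-- Feasibility of the 0/1-vector with support `S`. -/
def IPFeasible (P : PackingSystem R E) (S : Finset E) : Prop :=
  ∀ i, ∑ e ∈ S, P.A i e ≤ P.b i

/-- The 0/1-vector with support `S` is an optimal solution to the 0/1-integer program with
objective vector `c`. -/
def IPOptimal (P : PackingSystem R E) (c : E → ℕ) (S : Finset E) : Prop :=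
  P.IPFeasible S ∧ ∀ S', P.IPFeasible S' → ∑ e ∈ S', c e ≤ ∑ e ∈ S, c e

end PackingSystem

/-! ## The adaptive strategy -/

/-- What the algorithm has seen so far: for each past iteration, in chronological order, and each
element, the revealed weight if the element was queried in that iteration, and `none` if not. -/
abbrev History (E : Type*) := List (E → Option ℕ)

/-- The revealed weight of `e`, or `none` if `e` has never been queried. -/
def History.revealed {E : Type*} (h : History E) (e : E) : Option ℕ :=
  h.findSome? fun o => o e

/-- The optimistic vector: revealed weights, and `hi` where nothing has been revealed. -/
def StochasticWeight.optimistic {E : Type*} (w : StochasticWeight E) (h : History E) (e : E) : ℕ :=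
  (h.revealed e).getD (w.hi e)

/-- The pessimistic vector: revealed weights, and `lo` where nothing has been revealed. -/
def StochasticWeight.pessimistic {E : Type*} (w : StochasticWeight E) (h : History E) (e : E) : ℕ :=
  (h.revealed e).getD (w.lo e)

/-- The two subroutines that the adaptive strategy leaves open. Both see only the history and may
be randomized: `solve` returns an optimal solution to the optimistic LP, and `finish` returns an
integral feasible solution to the pessimistic LP. -/
structure AdaptiveStrategy {R E : Type*} [Fintype E] (P : PackingSystem R E)
    (w : StochasticWeight E) where
  /-- the LP solver -/
  solve : History E → PMF (E → ℝ)
  solve_optimal : ∀ h, ∀ x ∈ (solve h).support, P.LPOptimal (w.optimistic h) x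
  /-- the final step -/
  finish : History E → PMF (Finset E)
  finish_feasible : ∀ h, ∀ S ∈ (finish h).support, P.IPFeasible S

/-- The outcome of querying the elements marked by `q` when the realized weights are `c`. -/
def observe {E : Type*} (c : E → ℕ) (q : E → Bool) : E → Option ℕ :=
  fun e => if q e then some (c e) else none

namespace AdaptiveStrategy

variable {R E : Type*} [Fintype E] {P : PackingSystem R E} {w : StochasticWeight E}

/-- One iteration, when the realized weights are `c`: solve the optimistic LP, then query each
element `e` independently with probability `x e`. -/
def step (alg : AdaptiveStrategy P w) (c : E → ℕ) (h : History E) : PMF (History E) :=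
  (alg.solve h).bind fun x =>
    (indepLaw fun e => coin (x e)).bind fun q => PMF.pure (h ++ [observe c q])

/-- The history after `T` iterations, when the realized weights are `c`. -/
def run (alg : AdaptiveStrategy P w) (c : E → ℕ) : ℕ → PMF (History E)
  | 0 => PMF.pure []
  | t + 1 => (alg.run c t).bind (alg.step c)

/-- The joint law of the realized weights and the output after `T` iterations, over the
randomness of both the weights and the algorithm. -/
def outcome (alg : AdaptiveStrategy P w) (T : ℕ) : PMF ((E → ℕ) × Finset E) :=
  w.jointLaw.bind fun c =>
    (alg.run c T).bind fun h => (alg.finish h).bind fun S => PMF.pure (c, S)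

end AdaptiveStrategy

/-! ## Matroids -/

/-- The system `∑_{e ∈ S} x_e ≤ r(S)` for all `S ⊆ E`, with `r` the rank function of `M`. -/
def matroidSystem {E : Type*} [DecidableEq E] (M : Matroid E) : PackingSystem (Finset E) E where
  A := fun S e => if e ∈ S then 1 else 0
  b := fun S => (M.eRk (S : Set E)).toNat

end StochasticPacking

end

namespace StochasticPacking

/-! ## Sums over functions -/

/-! The proof is a union bound over integral dual solutions. A vector `u : E → ℕ` encodes the dual
solution with weight one on the span of `{i | k ≤ u i}` for each `k ≥ 1`; its cost is at most `∑ u`.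
If the output `S` fails, let `u` be the pessimistic weights on `S`, zero elsewhere. By optimality of
`S` this `u` covers all pessimistic weights (`covered_of_ipOptimal`), yet `∑ u` is less than `1 - ε`
times the optimistic value of some independent set. Such a `u` is called surviving.

Fix `u` and suppose that it survives so far. The optimistic LP value exceeds `∑ u` by more than `ε
(∑ u + 1)`. By weak duality (`LPFeasible.sum_mul_le`) this gap is paid by critical elements, those
still unqueried whose `hi` is uncovered, and each pays at most `width * x e`. Hence the critical
`x`-mass exceeds `ε (∑ u + 1) / width` when the width is positive (`Surviving.lt_width_mul_sum`).
Querying a critical element that realizes `hi` rules out `u` forever, so `u` survives the iteration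
with probability at most `exp (-p ε (∑ u + 1) / width)`. Conditioning on the history is harmless
because unqueried weights keep their independent laws (`exists_run_eq`).

After `T` iterations this is at most `(ε / m) ^ (2 (∑ u + 1))`. Summing over all of `ℕ ^ E` is a
product of geometric series, bounded by `ε` once `m ≥ 2`; the case `m = 1` is settled by one
iteration. -/

theorem tsum_prod_eq_prod_tsum {E α : Type*} [Fintype E] [Countable α] (f : E → α → ℝ≥0∞)
    (hf : ∀ e a, f e a ≠ ∞) : ∑' g : E → α, ∏ e, f e (g e) = ∏ e, ∑' a, f e a := by
  classical
  let _ : MeasurableSpace α := ⊤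
  have : DiscreteMeasurableSpace α := ⟨fun _ => trivial⟩
  -- Both sides are the total mass of the product of the measures with densities `f e`; finite
  -- values make these σ-finite.
  let μ : E → MeasureTheory.Measure α := fun e => MeasureTheory.Measure.count.withDensity (f e)
  have hσ : ∀ e, MeasureTheory.SigmaFinite (μ e) := fun e =>
    MeasureTheory.SigmaFinite.withDensity_of_ne_top' (hf e)
  have h1 : ∀ g : E → α, (MeasureTheory.Measure.pi μ) {g} = ∏ e, f e (g e) := by
    intro g
    rw [MeasureTheory.Measure.pi_singleton]
    refine Finset.prod_congr rfl fun e _ => ?_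
    rw [MeasureTheory.withDensity_apply _ (MeasurableSet.singleton _),
      MeasureTheory.lintegral_singleton, MeasureTheory.Measure.count_singleton, mul_one]
  have h2 : (MeasureTheory.Measure.pi μ) Set.univ = ∏ e, ∑' a, f e a := by
    rw [MeasureTheory.Measure.pi_univ]
    refine Finset.prod_congr rfl fun e _ => ?_
    rw [MeasureTheory.withDensity_apply _ MeasurableSet.univ, MeasureTheory.Measure.restrict_univ,
      MeasureTheory.lintegral_count]
  rw [← h2, ← MeasureTheory.Measure.tsum_indicator_apply_singleton _ _ MeasurableSet.univ]
  exact tsum_congr fun g => by rw [Set.indicator_univ, h1 g]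

/-! ## The linear program of a matroid -/

section Matroid

variable {E : Type*} [Fintype E] [DecidableEq E] {M : Matroid E}

omit [DecidableEq E] in
theorem coe_eRk_toNat (M : Matroid E) (S : Set E) : ((M.eRk S).toNat : ℕ∞) = M.eRk S :=
  ENat.natCast_toNat (ne_top_of_le_ne_top (Set.encard_ne_top_iff.2 S.toFinite) (M.eRk_le_encard S))

theorem matroidSystem_ipFeasible_iff {S : Finset E} :
    (matroidSystem M).IPFeasible S ↔ M.Indep (S : Set E) := by
  have key : ∀ F : Finset E, ∑ e ∈ S, (matroidSystem M).A F e = (S ∩ F).card := by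
    intro F
    simp [matroidSystem]
  constructor
  · intro h
    have h1 := h S
    rw [key, Finset.inter_self] at h1
    rw [Matroid.indep_iff_eRk_eq_encard_of_finite S.finite_toSet]
    refine le_antisymm (M.eRk_le_encard _) ?_
    rw [Set.encard_coe_eq_coe_finsetCard, ← coe_eRk_toNat]
    exact_mod_cast h1
  · intro h F
    rw [key]
    have : ((S ∩ F).card : ℕ∞) ≤ ((M.eRk (F : Set E)).toNat : ℕ∞) := by
      rw [coe_eRk_toNat, ← Set.encard_coe_eq_coe_finsetCard, Finset.coe_inter,
        ← (h.inter_right F).eRk_eq_encard]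
      exact M.eRk_mono Set.inter_subset_right
    exact_mod_cast this

theorem LPFeasible_indicator {R : Type*} {P : PackingSystem R E} {S : Finset E}
    (h : P.IPFeasible S) : P.LPFeasible fun e => if e ∈ S then 1 else 0 := by
  refine ⟨fun e => by dsimp only; split_ifs <;> norm_num, fun i => ?_⟩
  have := h i
  simpa using (by exact_mod_cast this : (∑ e ∈ S, (P.A i e : ℝ)) ≤ P.b i)

/-- The rank of `F` is at most that of the span of `S`, hence at most `|S|`. This is the price of
one unit of dual weight on a span. -/
theorem LPFeasible.sum_le_card {x : E → ℝ} (hx : (matroidSystem M).LPFeasible x)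
    {F S : Finset E} (h : (F : Set E) ⊆ M.closure S) : ∑ e ∈ F, x e ≤ S.card := by
  have h1 := hx.2 F
  have h2 : ∑ e, ((matroidSystem M).A F e : ℝ) * x e = ∑ e ∈ F, x e := by
    simp [matroidSystem]
  rw [h2] at h1
  refine h1.trans ?_
  have : ((M.eRk (F : Set E)).toNat : ℕ∞) ≤ S.card := by
    rw [coe_eRk_toNat, ← Set.encard_coe_eq_coe_finsetCard]
    exact (M.eRk_mono h).trans ((M.eRk_closure_eq _).le.trans (M.eRk_le_encard _))
  have h3 : (M.eRk (F : Set E)).toNat ≤ S.card := by exact_mod_cast this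
  exact_mod_cast h3

theorem LPFeasible.le_one {x : E → ℝ} (hM : M.E = Set.univ)
    (hx : (matroidSystem M).LPFeasible x) (e : E) : x e ≤ 1 := by
  have := LPFeasible.sum_le_card hx (F := {e}) (S := {e})
    (M.subset_closure _ (by simp [hM]))
  simpa using this

/-- The weight `a` of the element `e` is covered by the dual solution that puts weight one on the
span of `{i | k ≤ u i}` for each `k ≥ 1`. -/
def Covered (M : Matroid E) (u : E → ℕ) (e : E) (a : ℕ) : Prop :=
  e ∈ M.closure {i | a ≤ u i}

omit [Fintype E] [DecidableEq E] in
theorem Covered.anti {u : E → ℕ} {e : E} {a b : ℕ} (h : Covered M u e b) (hab : a ≤ b) :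
    Covered M u e a :=
  M.closure_subset_closure (fun _ hi => hab.trans hi) h

/-- An optimal solution with pessimistic weights covers these weights. -/
theorem covered_of_ipOptimal (hM : M.E = Set.univ) {c : E → ℕ} {S : Finset E}
    (hS : (matroidSystem M).IPOptimal c S) (e : E) :
    Covered M (fun i => if i ∈ S then c i else 0) e (c e) := by
  have hI : M.Indep (S : Set E) := matroidSystem_ipFeasible_iff.1 hS.1
  rcases Nat.eq_zero_or_pos (c e) with h0 | hpos
  · have : {i | c e ≤ (fun i => if i ∈ S then c i else 0) i} = M.E := by
      rw [hM, h0]; simp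
    unfold Covered
    rw [this, M.closure_ground, hM]
    trivial
  have hset : {i | c e ≤ (fun i => if i ∈ S then c i else 0) i}
      = ((S.filter fun i => c e ≤ c i : Finset E) : Set E) := by
    ext i
    by_cases hi : i ∈ S <;> simp [hi, hpos.ne']
  unfold Covered
  rw [hset]
  set K := S.filter fun i => c e ≤ c i with hK
  by_contra hcl
  have hKS : (K : Set E) ⊆ S := by exact_mod_cast Finset.filter_subset _ _
  have hKI : M.Indep (K : Set E) := hI.subset hKS
  have heS : e ∉ S := fun he => hcl
    (M.subset_closure _ (by simp [hM]) (by simp [hK, he]))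
  have hins : M.Indep (insert e (K : Set E)) := by
    rw [Matroid.insert_indep_iff]
    exact ⟨hKI, fun _ => ⟨by simp [hM], hcl⟩⟩
  -- Exchange argument: a basis `B` of `S + e` containing `K + e` omits at most one element of `S`,
  -- and that element lies outside `K`, so it weighs less than `c e`. Thus `B` outweighs `S`.
  obtain ⟨B, hB, hKB⟩ := hins.subset_isBasis_of_subset (Set.insert_subset_insert hKS (a := e))
    (by simp [hM])
  obtain ⟨B, rfl⟩ := B.toFinite.exists_finset_coe
  have hcard : S.card ≤ B.card := by
    have : (S.card : ℕ∞) ≤ B.card := by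
      rw [← Set.encard_coe_eq_coe_finsetCard, ← Set.encard_coe_eq_coe_finsetCard,
        hB.encard_eq_eRk, ← hI.eRk_eq_encard]
      exact M.eRk_mono (Set.subset_insert _ _)
    exact_mod_cast this
  have hBsub : B ⊆ insert e S := by exact_mod_cast hB.subset
  have heB : e ∈ B := by exact_mod_cast hKB (Set.mem_insert _ _)
  have hopt := hS.2 B (matroidSystem_ipFeasible_iff.2 hB.indep)
  have hsum : ∑ i ∈ insert e S \ B, c i + ∑ i ∈ B, c i = ∑ i ∈ insert e S, c i :=
    Finset.sum_sdiff hBsub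
  rw [Finset.sum_insert heS] at hsum
  have hc1 : (insert e S \ B).card ≤ 1 := by
    have := Finset.card_sdiff_add_card_eq_card hBsub
    rw [Finset.card_insert_of_notMem heS] at this
    omega
  have hlt : ∑ i ∈ insert e S \ B, c i < c e := by
    have : Nonempty E := ⟨e⟩
    rcases Finset.card_le_one_iff_subset_singleton.1 hc1 with ⟨j, hj⟩
    by_cases hj' : j ∈ insert e S \ B
    · have heq : insert e S \ B = {j} :=
        Finset.Subset.antisymm hj (Finset.singleton_subset_iff.2 hj')
      rw [heq, Finset.sum_singleton]
      by_contra hcon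
      rw [Finset.mem_sdiff, Finset.mem_insert] at hj'
      rcases hj'.1 with rfl | hjS
      · exact hj'.2 heB
      · refine hj'.2 ?_
        have : j ∈ (K : Set E) := by
          simp only [hK, Finset.coe_filter, Set.mem_ofPred_eq]
          exact ⟨hjS, not_lt.1 hcon⟩
        exact_mod_cast hKB (Set.mem_insert_of_mem _ this)
    · have : insert e S \ B = ∅ := by
        refine Finset.eq_empty_of_forall_notMem fun i hi => hj' ?_
        have := Finset.mem_singleton.1 (hj hi)
        exact this ▸ hi
      rw [this, Finset.sum_empty]
      exact hpos
  omega

open Classical in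
/-- Weak duality with the dual solution given by `u`, up to the uncovered part of the weights. -/
theorem LPFeasible.sum_mul_le {x : E → ℝ} (hx : (matroidSystem M).LPFeasible x) (u c : E → ℕ) :
    ∑ e, (c e : ℝ) * x e ≤ ∑ e, (u e : ℝ) +
      ∑ e, (((Finset.Icc 1 (c e)).filter fun k => ¬ Covered M u e k).card : ℝ) * x e := by
  set N := Finset.univ.sup c with hN
  have hcN : ∀ e, c e ≤ N := fun e => Finset.le_sup (f := c) (Finset.mem_univ e)
  have h1 : ∀ e, (c e : ℝ) = (((Finset.Icc 1 (c e)).filter fun k => Covered M u e k).card : ℝ)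
      + (((Finset.Icc 1 (c e)).filter fun k => ¬ Covered M u e k).card : ℝ) := by
    intro e
    have := Finset.card_filter_add_card_filter_not (s := Finset.Icc 1 (c e))
      (fun k => Covered M u e k)
    rw [Nat.card_Icc, Nat.add_sub_cancel] at this
    exact_mod_cast this.symm
  have h2 : ∑ e, (((Finset.Icc 1 (c e)).filter fun k => Covered M u e k).card : ℝ) * x e
      ≤ ∑ e, (u e : ℝ) := by
    -- Sum by levels: at level `k` the covered elements lie in the span of `{i | k ≤ u i}`, and the
    -- sizes of these sets add up to at most `∑ u`.
    calc _ ≤ ∑ e, ∑ k ∈ Finset.Icc 1 N, if Covered M u e k then x e else 0 := by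
          refine Finset.sum_le_sum fun e _ => ?_
          rw [← Finset.sum_filter, Finset.sum_const, nsmul_eq_mul]
          refine mul_le_mul_of_nonneg_right ?_ (hx.1 e)
          exact_mod_cast Finset.card_le_card
            (Finset.filter_subset_filter _ (Finset.Icc_subset_Icc_right (hcN e)))
      _ = ∑ k ∈ Finset.Icc 1 N, ∑ e ∈ Finset.univ.filter (fun e => Covered M u e k), x e := by
          rw [Finset.sum_comm]
          exact Finset.sum_congr rfl fun k _ => (Finset.sum_filter _ _).symm
      _ ≤ ∑ k ∈ Finset.Icc 1 N, ((Finset.univ.filter fun i => k ≤ u i).card : ℝ) := by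
          refine Finset.sum_le_sum fun k _ => LPFeasible.sum_le_card hx ?_
          intro e he
          rw [Finset.coe_filter_univ]
          exact (Finset.mem_filter.1 (Finset.mem_coe.1 he)).2
      _ = ∑ e, (((Finset.Icc 1 N).filter fun k => k ≤ u e).card : ℝ) := by
          simp_rw [Finset.card_filter]
          push_cast
          rw [Finset.sum_comm]
      _ ≤ ∑ e, (u e : ℝ) := by
          refine Finset.sum_le_sum fun e _ => ?_
          have : ((Finset.Icc 1 N).filter fun k => k ≤ u e) ⊆ Finset.Icc 1 (u e) := by
            intro k hk
            simp only [Finset.mem_filter, Finset.mem_Icc] at hk ⊢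
            exact ⟨hk.1.1, hk.2⟩
          have := Finset.card_le_card this
          rw [Nat.card_Icc, Nat.add_sub_cancel] at this
          exact_mod_cast this
  calc ∑ e, (c e : ℝ) * x e
      = ∑ e, (((Finset.Icc 1 (c e)).filter fun k => Covered M u e k).card : ℝ) * x e +
        ∑ e, (((Finset.Icc 1 (c e)).filter fun k => ¬ Covered M u e k).card : ℝ) * x e := by
        rw [← Finset.sum_add_distrib]
        exact Finset.sum_congr rfl fun e _ => by rw [← add_mul, ← h1 e]
    _ ≤ _ := by gcongr

end Matroid

/-! ## Histories -/

section History

variable {E : Type*}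

theorem History.revealed_append (h : History E) (o : E → Option ℕ) (e : E) :
    History.revealed (h ++ [o]) e = (h.revealed e).or (o e) := by
  unfold History.revealed
  rw [List.findSome?_append]
  simp [List.findSome?_cons]
  cases o e <;> simp

/-- The weight `a` of `e` agrees with all observations of `e`. -/
def History.Compatible (h : History E) (e : E) (a : ℕ) : Prop :=
  ∀ o ∈ h, ∀ b, o e = some b → a = b

theorem History.Compatible.eq_of_revealed {h : History E} {e : E} {a b : ℕ}
    (ha : h.Compatible e a) (hb : h.revealed e = some b) : a = b := by
  obtain ⟨o, ho, hob⟩ := List.exists_of_findSome?_eq_some hb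
  exact ha o ho b hob

theorem History.compatible_of_revealed_eq_none {h : History E} {e : E}
    (hh : h.revealed e = none) (a : ℕ) : h.Compatible e a := by
  intro o ho b hob
  have := (List.findSome?_eq_none_iff.1 hh) o ho
  simp [hob] at this

theorem History.compatible_append_observe {h : History E} {c : E → ℕ} {q : E → Bool}
    (hc : ∀ e, h.Compatible e (c e)) (e : E) :
    History.Compatible (h ++ [observe c q]) e (c e) := by
  intro o ho b hob
  rcases List.mem_append.1 ho with ho | ho
  · exact hc e o ho b hob
  · rw [List.mem_singleton.1 ho] at hob
    unfold observe at hob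
    split_ifs at hob
    exact Option.some.inj hob

variable {w : StochasticWeight E} {h : History E} {c : E → ℕ} {q : E → Bool}

theorem pessimistic_le_append (hc : ∀ e, w.lo e ≤ c e) (e : E) :
    w.pessimistic h e ≤ w.pessimistic (h ++ [observe c q]) e := by
  unfold StochasticWeight.pessimistic
  rw [History.revealed_append]
  cases h.revealed e with
  | some b => simp
  | none => by_cases hq : q e <;> simp [observe, hq, hc e]

theorem optimistic_append_le (hc : ∀ e, c e ≤ w.hi e) (e : E) :
    w.optimistic (h ++ [observe c q]) e ≤ w.optimistic h e := by
  unfold StochasticWeight.optimistic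
  rw [History.revealed_append]
  cases h.revealed e with
  | some b => simp
  | none => by_cases hq : q e <;> simp [observe, hq, hc e]

theorem pessimistic_append_of_query {e : E} (hh : h.revealed e = none) (hq : q e = true) :
    w.pessimistic (h ++ [observe c q]) e = c e := by
  unfold StochasticWeight.pessimistic
  rw [History.revealed_append, hh]
  simp [observe, hq]

theorem optimistic_eq_pessimistic_of_query {e : E} (hq : q e = true) :
    w.optimistic (h ++ [observe c q]) e = w.pessimistic (h ++ [observe c q]) e := by
  unfold StochasticWeight.pessimistic StochasticWeight.optimistic
  rw [History.revealed_append]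
  cases h.revealed e <;> simp [observe, hq]

theorem pessimistic_le_of_compatible (hc : ∀ e, w.lo e ≤ c e)
    (hh : ∀ e, h.Compatible e (c e)) (e : E) : w.pessimistic h e ≤ c e := by
  unfold StochasticWeight.pessimistic
  cases hb : h.revealed e with
  | some b => simp [(hh e).eq_of_revealed hb]
  | none => simpa using hc e

theorem le_optimistic_of_compatible (hc : ∀ e, c e ≤ w.hi e)
    (hh : ∀ e, h.Compatible e (c e)) (e : E) : c e ≤ w.optimistic h e := by
  unfold StochasticWeight.optimistic
  cases hb : h.revealed e with
  | some b => simp [(hh e).eq_of_revealed hb]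
  | none => simpa using hc e

end History

/-! ## Surviving dual solutions -/

section Surviving

variable {E : Type*} [Fintype E] [DecidableEq E] {M : Matroid E} {w : StochasticWeight E}
  {ε : ℝ} {u : E → ℕ} {h : History E}

/-- The dual solution given by `u` covers the pessimistic weights and shows that they are not
sufficient for a `(1 - ε)`-approximation with respect to the optimistic weights. -/
def Surviving (M : Matroid E) (w : StochasticWeight E) (ε : ℝ) (u : E → ℕ) (h : History E) :
    Prop :=
  (∀ e, Covered M u e (w.pessimistic h e)) ∧
    ∃ J : Finset E, M.Indep (J : Set E) ∧
      ∑ e, (u e : ℝ) < (1 - ε) * ∑ e ∈ J, (w.optimistic h e : ℝ)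

open Classical in
/-- The elements not queried so far whose query may rule out the dual solution given by `u`. -/
noncomputable def critical (M : Matroid E) (w : StochasticWeight E) (u : E → ℕ) (h : History E) : Finset E :=
  Finset.univ.filter fun e => h.revealed e = none ∧ ¬ Covered M u e (w.hi e)

-- Pessimistic weights only rise and optimistic weights only fall, so survival, once lost, is never
-- regained.
omit [DecidableEq E] in
theorem Surviving.of_append (hε : ε < 1) {c : E → ℕ} {q : E → Bool}
    (hlo : ∀ e, w.lo e ≤ c e) (hhi : ∀ e, c e ≤ w.hi e)
    (hs : Surviving M w ε u (h ++ [observe c q])) : Surviving M w ε u h := by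
  obtain ⟨h1, J, hJ, h2⟩ := hs
  refine ⟨fun e => (h1 e).anti (pessimistic_le_append hlo e), J, hJ, h2.trans_le ?_⟩
  refine mul_le_mul_of_nonneg_left (Finset.sum_le_sum fun e _ => ?_) (by linarith)
  exact_mod_cast optimistic_append_le hhi e

-- Revealing `hi` at a critical element lifts its pessimistic weight to an uncovered level.
omit [DecidableEq E] in
theorem Surviving.ne_hi_of_append {c : E → ℕ} {q : E → Bool}
    (hs : Surviving M w ε u (h ++ [observe c q])) {e : E} (he : e ∈ critical M w u h)
    (hq : q e = true) : c e ≠ w.hi e := by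
  intro heq
  simp only [critical, Finset.mem_filter, Finset.mem_univ, true_and] at he
  have := hs.1 e
  rw [pessimistic_append_of_query he.1 hq, heq] at this
  exact he.2 this

/-- Weak duality bounds the gap between the LP value and `∑ u` by the uncovered levels. Since
pessimistic weights are covered, only critical elements have such levels, all in `(lo e, hi e]`. -/
theorem Surviving.lt_width_mul_sum (hε : 0 < ε) (hs : Surviving M w ε u h) {x : E → ℝ}
    (hx : (matroidSystem M).LPOptimal (w.optimistic h) x) :
    ε * (∑ e, (u e : ℝ) + 1) < w.width * ∑ e ∈ critical M w u h, x e := by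
  classical
  obtain ⟨hcov, J, hJ, hlt⟩ := hs
  have h1 := hx.2 _ (LPFeasible_indicator (matroidSystem_ipFeasible_iff.2 hJ))
  have h2 := LPFeasible.sum_mul_le hx.1 u (w.optimistic h)
  have h3 : ∑ e, (w.optimistic h e : ℝ) * (if e ∈ J then (1 : ℝ) else 0)
      = ∑ e ∈ J, (w.optimistic h e : ℝ) := by simp
  rw [h3] at h1
  have h4 : ∑ e, (((Finset.Icc 1 (w.optimistic h e)).filter
      fun k => ¬ Covered M u e k).card : ℝ) * x e
      ≤ w.width * ∑ e ∈ critical M w u h, x e := by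
    rw [Finset.mul_sum, critical, Finset.sum_filter]
    refine Finset.sum_le_sum fun e _ => ?_
    have hpess := hcov e
    cases hr : h.revealed e with
    | some b =>
      have hz : (Finset.Icc 1 (w.optimistic h e)).filter (fun k => ¬ Covered M u e k) = ∅ := by
        refine Finset.filter_eq_empty_iff.2 fun k hk => not_not.2 (hpess.anti ?_)
        simpa [StochasticWeight.optimistic, StochasticWeight.pessimistic, hr] using
          (Finset.mem_Icc.1 hk).2
      rw [hz]
      simp
    | none =>
      have ho : w.optimistic h e = w.hi e := by simp [StochasticWeight.optimistic, hr]
      have hp : w.pessimistic h e = w.lo e := by simp [StochasticWeight.pessimistic, hr]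
      rw [hp] at hpess
      rw [ho]
      by_cases hc : Covered M u e (w.hi e)
      · have hz : (Finset.Icc 1 (w.hi e)).filter (fun k => ¬ Covered M u e k) = ∅ :=
          Finset.filter_eq_empty_iff.2 fun k hk => not_not.2 (hc.anti (Finset.mem_Icc.1 hk).2)
        rw [hz]
        simp [hc]
      · simp only [hc, not_false_eq_true, and_self, if_true]
        refine mul_le_mul_of_nonneg_right ?_ (hx.1.1 e)
        have hsub : (Finset.Icc 1 (w.hi e)).filter (fun k => ¬ Covered M u e k)
            ⊆ Finset.Ioc (w.lo e) (w.hi e) := by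
          intro k hk
          rw [Finset.mem_filter, Finset.mem_Icc] at hk
          exact Finset.mem_Ioc.2 ⟨not_le.1 fun hle => hk.2 (hpess.anti hle), hk.1.2⟩
        have hcard := Finset.card_le_card hsub
        rw [Nat.card_Ioc] at hcard
        have hw : w.hi e - w.lo e ≤ w.width :=
          Finset.le_sup (f := fun e => w.hi e - w.lo e) (Finset.mem_univ e)
        exact_mod_cast hcard.trans hw
  -- Integrality turns the strict gap into `+ 1`, which keeps the decay rate positive even for `u =
  -- 0`.
  have h5 : ∑ e, (u e : ℝ) + 1 ≤ ∑ e ∈ J, (w.optimistic h e : ℝ) := by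
    have : ∑ e, (u e : ℝ) < ∑ e ∈ J, (w.optimistic h e : ℝ) := by
      have : 0 ≤ ∑ e ∈ J, (w.optimistic h e : ℝ) := Finset.sum_nonneg fun _ _ => by positivity
      nlinarith
    have h6 : ∑ e, u e < ∑ e ∈ J, w.optimistic h e := by exact_mod_cast this
    exact_mod_cast h6
  have h6 := mul_le_mul_of_nonneg_left h5 hε.le
  linarith

/-- With a single element, no dual solution survives an iteration. -/
theorem not_surviving_of_subsingleton [Subsingleton E] (hε : 0 < ε) {c : E → ℕ}
    {q : E → Bool} (hhi : ∀ e, c e ≤ w.hi e) {x : E → ℝ}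
    (hx : (matroidSystem M).LPOptimal (w.optimistic h) x) (hq : ∀ e, 1 ≤ x e → q e = true) :
    ¬ Surviving M w ε u (h ++ [observe c q]) := by
  rintro ⟨hcov, J, hJ, hlt⟩
  have hu : 0 ≤ ∑ e, (u e : ℝ) := Finset.sum_nonneg fun _ _ => by positivity
  rcases J.eq_empty_or_nonempty with rfl | ⟨e, he⟩
  · simp at hlt
    linarith
  have hJe : J = {e} := Finset.eq_singleton_iff_unique_mem.2 ⟨he, fun _ _ => Subsingleton.elim _ _⟩
  have hsum : ∀ f : E → ℝ, ∑ i, f i = f e := fun f =>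
    Fintype.sum_eq_single e fun i hi => absurd (Subsingleton.elim i e) hi
  rw [hJe, Finset.sum_singleton, hsum] at hlt
  set a := w.optimistic (h ++ [observe c q]) e with ha
  have hua : u e < a := by
    have h1 : (0 : ℝ) ≤ a := by positivity
    have : (u e : ℝ) < a := by nlinarith
    exact_mod_cast this
  have hle := optimistic_append_le (h := h) (q := q) hhi e
  have hpos : (0 : ℝ) < w.optimistic h e := by
    have : 0 < w.optimistic h e := by omega
    exact_mod_cast this
  have hopt := hx.2 _ (LPFeasible_indicator (matroidSystem_ipFeasible_iff.2 hJ))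
  rw [hsum, hsum, if_pos he, mul_one] at hopt
  -- Comparing `x` with the indicator of `{e}` at positive weight forces `x e ≥ 1`.
  have hqe := hq e (by nlinarith)
  have hc := hcov e
  rw [← optimistic_eq_pessimistic_of_query hqe, ← ha] at hc
  have hempty : {i | a ≤ u i} = (∅ : Set E) := by
    ext i
    rw [Subsingleton.elim i e]
    simpa using hua
  unfold Covered at hc
  rw [hempty] at hc
  rw [hJe, Finset.coe_singleton] at hJ
  have h7 := (M.insert_indep_iff (I := ∅) (e := e)).1 (by simpa using hJ)
  exact (h7.2 (by simp)).2 hc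

/-- A solution that is optimal for the pessimistic weights, but no `(1 - ε)`-approximation for the
realized ones, leaves a surviving dual solution. -/
theorem surviving_of_failure (hM : M.E = Set.univ) (hε : ε < 1) {c : E → ℕ}
    (hlo : ∀ e, w.lo e ≤ c e) (hhi : ∀ e, c e ≤ w.hi e) (hh : ∀ e, h.Compatible e (c e))
    {S J : Finset E} (hS : (matroidSystem M).IPOptimal (w.pessimistic h) S)
    (hJ : M.Indep (J : Set E))
    (hfail : ∑ e ∈ S, (c e : ℝ) < (1 - ε) * ∑ e ∈ J, (c e : ℝ)) :
    Surviving M w ε (fun i => if i ∈ S then w.pessimistic h i else 0) h := by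
  refine ⟨covered_of_ipOptimal hM hS, J, hJ, ?_⟩
  calc ∑ e, ((if e ∈ S then w.pessimistic h e else 0 : ℕ) : ℝ)
      = ∑ e ∈ S, (w.pessimistic h e : ℝ) := by simp
    _ ≤ ∑ e ∈ S, (c e : ℝ) := Finset.sum_le_sum fun e _ => by
        exact_mod_cast pessimistic_le_of_compatible hlo hh e
    _ < (1 - ε) * ∑ e ∈ J, (c e : ℝ) := hfail
    _ ≤ _ := mul_le_mul_of_nonneg_left (Finset.sum_le_sum fun e _ => by
        exact_mod_cast le_optimistic_of_compatible hhi hh e) (by linarith)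

end Surviving

/-! ## The law of the history -/

theorem indepLaw_apply {E α : Type*} [Fintype E] [Countable α] (D : E → PMF α) (f : E → α) :
    indepLaw D f = ∏ e, D e (f e) := rfl

theorem coin_true {x : ℝ} (h0 : 0 ≤ x) (h1 : x ≤ 1) : coin x true = ENNReal.ofReal x := by
  simp [coin, h0, h1]

theorem coin_false_of_one_le {x : ℝ} (h1 : 1 ≤ x) : coin x false = 0 := by
  simp [coin, h1]

/-- The elements of weight `k` are discovered with probability at least `p x`. -/
theorem tsum_coin_miss_le (D : PMF ℕ) {k : ℕ} {p x : ℝ} (hp : 0 ≤ p)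
    (hD : ENNReal.ofReal p ≤ D k) (h0 : 0 ≤ x) (h1 : x ≤ 1) :
    ∑' a, D a * ∑ b, coin x b * (if b = true ∧ a = k then 0 else 1)
      ≤ ENNReal.ofReal (Real.exp (-(p * x))) := by
  have hcoin : coin x true + coin x false = 1 := by
    have := (coin x).tsum_coe
    rwa [tsum_fintype, Fintype.sum_bool] at this
  have hg : ∀ a, (∑ b, coin x b * (if b = true ∧ a = k then 0 else 1))
      + (if a = k then ENNReal.ofReal x else 0) = 1 := by
    intro a
    rw [Fintype.sum_bool]
    by_cases ha : a = k
    · simp only [ha, and_true, if_true, mul_zero, zero_add, mul_one, Bool.false_eq_true, if_false]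
      rw [← coin_true h0 h1, add_comm, hcoin]
    · simp [ha, hcoin]
  have hsum : (∑' a, D a * ∑ b, coin x b * (if b = true ∧ a = k then 0 else 1))
      + D k * ENNReal.ofReal x = 1 := by
    have h2 : ∑' a, D a * (if a = k then ENNReal.ofReal x else 0) = D k * ENNReal.ofReal x := by
      rw [tsum_eq_single k fun a ha => by simp [ha]]
      simp
    rw [← h2, ← ENNReal.tsum_add]
    exact (tsum_congr fun a => by rw [← mul_add, hg, mul_one]).trans D.tsum_coe
  have hpx : ENNReal.ofReal (p * x) ≤ D k * ENNReal.ofReal x := by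
    rw [ENNReal.ofReal_mul hp]
    gcongr
  have h3 : (∑' a, D a * ∑ b, coin x b * (if b = true ∧ a = k then 0 else 1))
      ≤ 1 - ENNReal.ofReal (p * x) := by
    refine ENNReal.le_sub_of_add_le_right ENNReal.ofReal_ne_top ?_
    exact (add_le_add_right hpx _).trans hsum.le
  refine h3.trans ?_
  rw [← ENNReal.ofReal_one, ← ENNReal.ofReal_sub _ (mul_nonneg hp h0)]
  refine ENNReal.ofReal_le_ofReal ?_
  linarith [Real.add_one_le_exp (-(p * x))]

theorem StochasticWeight.lo_le_and_le_hi {E : Type*} [Fintype E] {w : StochasticWeight E}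
    {c : E → ℕ} (hc : w.jointLaw c ≠ 0) : (∀ e, w.lo e ≤ c e) ∧ ∀ e, c e ≤ w.hi e := by
  have h1 : ∀ e, c e ∈ Set.Icc (w.lo e) (w.hi e) := fun e =>
    w.support_law e ((PMF.mem_support_iff _ _).2 fun h0 =>
      hc (Finset.prod_eq_zero (Finset.mem_univ e) h0))
  exact ⟨fun e => (h1 e).1, fun e => (h1 e).2⟩

namespace AdaptiveStrategy

open Classical in
/-- The law of the history depends on the realized weights only through compatibility. -/
theorem exists_run_eq {R E : Type*} [Fintype E] {P : PackingSystem R E} {w : StochasticWeight E}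
    (alg : AdaptiveStrategy P w) (t : ℕ) :
    ∃ K : History E → ℝ≥0∞, ∀ c h,
      alg.run c t h = if ∀ e, h.Compatible e (c e) then K h else 0 := by
  induction t with
  | zero =>
    refine ⟨PMF.pure [], fun c h => ?_⟩
    change PMF.pure [] h = _
    by_cases hh : h = []
    · rw [if_pos]
      intro e o ho
      simp [hh] at ho
    · simp [PMF.pure_apply, hh]
  | succ t ih =>
    obtain ⟨K, hK⟩ := ih
    -- The kernel only asks that the newly observed coordinates be those marked by `q`; that their
    -- values equal `c` is left to compatibility.
    refine ⟨fun h' => ∑' h, K h * ∑' x, alg.solve h x *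
      ∑' q : E → Bool, (indepLaw fun e => coin (x e)) q *
        if ∃ o : E → Option ℕ, h' = h ++ [o] ∧ ∀ e, q e = (o e).isSome then 1 else 0, fun c h' => ?_⟩
    have hrun : alg.run c (t + 1) h' = ∑' h, alg.run c t h * ∑' x, alg.solve h x *
        ∑' q : E → Bool, (indepLaw fun e => coin (x e)) q *
          if h' = h ++ [observe c q] then 1 else 0 := by
      simp only [AdaptiveStrategy.run, AdaptiveStrategy.step, PMF.bind_apply, PMF.pure_apply]
      congr!
    rw [hrun]
    split_ifs with hc
    · refine tsum_congr fun h => ?_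
      by_cases hp : ∃ o, h' = h ++ [o]
      · obtain ⟨o, rfl⟩ := hp
        have hch : ∀ e, h.Compatible e (c e) := fun e o' ho' =>
          hc e o' (List.mem_append_left _ ho')
        have ho : ∀ e b, o e = some b → c e = b := fun e b =>
          hc e o (List.mem_append_right _ (List.mem_singleton_self o)) b
        rw [hK, if_pos hch]
        congr 1
        refine tsum_congr fun x => ?_
        congr 1
        refine tsum_congr fun q => ?_
        congr 1
        refine if_congr ?_ rfl rfl
        simp only [List.append_cancel_left_eq, List.cons.injEq, and_true]
        constructor
        · rintro rfl
          exact ⟨_, rfl, fun e => by by_cases hq : q e <;> simp [observe, hq]⟩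
        · rintro ⟨o', rfl, hq⟩
          funext e
          have := ho e
          unfold observe
          rw [hq e]
          cases hoe : o e with
          | none => simp
          | some b => simp [ho e b hoe]
      · have h1 : ∀ q, h' ≠ h ++ [observe c q] := fun q hq => hp ⟨_, hq⟩
        have h2 : ∀ q : E → Bool, ¬ ∃ o : E → Option ℕ, h' = h ++ [o] ∧ ∀ e, q e = (o e).isSome :=
          fun q ⟨o, ho, _⟩ => hp ⟨o, ho⟩
        simp [h1, h2]
    · rw [ENNReal.tsum_eq_zero]
      intro h
      rw [hK]
      split_ifs with hch
      · have h1 : ∀ q, h' ≠ h ++ [observe c q] := by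
          rintro q rfl
          exact hc (History.compatible_append_observe hch)
        simp [h1]
      · simp

end AdaptiveStrategy

/-! ### Survival probability of a fixed dual solution, and reduction of failure to survival -/

section Survival

variable {E : Type*} [Fintype E] [DecidableEq E] {M : Matroid E} {w : StochasticWeight E}
  {ε p : ℝ} {u : E → ℕ}

open Classical in
/-- The probability that the dual solution given by `u` survives one more iteration, jointly with
the history `h`. -/
theorem tsum_surviving_append_le (hM : M.E = Set.univ) (hp : 0 ≤ p)
    (hlaw : ∀ e, ENNReal.ofReal p ≤ w.law e (w.hi e)) (hε0 : 0 < ε) (hε1 : ε < 1)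
    {h : History E} {x : E → ℝ} (hx : (matroidSystem M).LPOptimal (w.optimistic h) x) :
    ∑' c, ∑' q : E → Bool, w.jointLaw c * (indepLaw fun e => coin (x e)) q *
        (if (∀ e, h.Compatible e (c e)) ∧ Surviving M w ε u (h ++ [observe c q]) then 1 else 0)
      ≤ ENNReal.ofReal (Real.exp (-(p * (ε * (∑ e, (u e : ℝ) + 1) / w.width)))) *
        ∑' c, w.jointLaw c *
          (if (∀ e, h.Compatible e (c e)) ∧ Surviving M w ε u h then 1 else 0) := by
  by_cases hs : Surviving M w ε u h
  swap
  · refine le_of_eq_of_le ?_ (zero_le)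
    rw [ENNReal.tsum_eq_zero]
    intro c
    rw [ENNReal.tsum_eq_zero]
    intro q
    by_cases hc : w.jointLaw c = 0
    · simp [hc]
    · obtain ⟨hlo, hhi⟩ := StochasticWeight.lo_le_and_le_hi hc
      rw [if_neg, mul_zero]
      exact fun hh => hs (hh.2.of_append hε1 hlo hhi)
  -- Survival is relaxed to "no critical element is queried at value `hi`", an event that factorizes
  -- over the elements.
  set F : E → ℕ → Bool → ℝ≥0∞ := fun e a b => w.law e a * coin (x e) b *
    (if h.Compatible e a then 1 else 0) *
    (if e ∈ critical M w u h ∧ b = true ∧ a = w.hi e then 0 else 1) with hF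
  have hFtop : ∀ e a b, F e a b ≠ ∞ := by
    intro e a b
    simp only [hF]
    refine ENNReal.mul_ne_top (ENNReal.mul_ne_top (ENNReal.mul_ne_top (PMF.apply_ne_top _ _)
      (PMF.apply_ne_top _ _)) ?_) ?_ <;> split_ifs <;> simp
  have hterm : ∀ (c : E → ℕ) (q : E → Bool),
      w.jointLaw c * (indepLaw fun e => coin (x e)) q *
        (if (∀ e, h.Compatible e (c e)) ∧ Surviving M w ε u (h ++ [observe c q]) then 1 else 0)
      ≤ ∏ e, F e (c e) (q e) := by
    intro c q
    split_ifs with hcq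
    · rw [mul_one]
      refine le_of_eq ?_
      unfold StochasticWeight.jointLaw
      rw [indepLaw_apply, indepLaw_apply, ← Finset.prod_mul_distrib]
      refine Finset.prod_congr rfl fun e _ => ?_
      simp only [hF]
      rw [if_pos (hcq.1 e), if_neg fun hbad => hcq.2.ne_hi_of_append hbad.1 hbad.2.1 hbad.2.2,
        mul_one, mul_one]
    · simp
  have hx0 := hx.1.1
  have hx1 := LPFeasible.le_one hM hx.1
  have hfactor : ∀ e, ∑' a, ∑ b, F e a b ≤
      (if e ∈ critical M w u h then ENNReal.ofReal (Real.exp (-(p * x e))) else 1) *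
        ∑' a, w.law e a * (if h.Compatible e a then 1 else 0) := by
    intro e
    by_cases he : e ∈ critical M w u h
    · have hnone : h.revealed e = none := (Finset.mem_filter.1 he).2.1
      have hcomp : ∀ a, h.Compatible e a := History.compatible_of_revealed_eq_none hnone
      simp only [hF, he, hcomp, if_true, mul_one, one_mul, true_and, PMF.tsum_coe, mul_assoc,
        ← Finset.mul_sum]
      exact tsum_coin_miss_le _ hp (hlaw e) (hx0 e) (hx1 e)
    · have hcoin : ∑ b, coin (x e) b = 1 :=
        (tsum_fintype _).symm.trans (PMF.tsum_coe _)
      simp only [hF, he, false_and, if_false, mul_one, one_mul]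
      refine ENNReal.tsum_le_tsum fun a => le_of_eq ?_
      rw [← Finset.sum_mul, ← Finset.mul_sum, hcoin, mul_one]
  have hcrit : (∏ e, if e ∈ critical M w u h then ENNReal.ofReal (Real.exp (-(p * x e))) else 1)
      ≤ ENNReal.ofReal (Real.exp (-(p * (ε * (∑ e, (u e : ℝ) + 1) / w.width)))) := by
    rw [Finset.prod_ite_mem, Finset.univ_inter,
      ← ENNReal.ofReal_prod_of_nonneg fun e _ => (Real.exp_pos _).le, ← Real.exp_sum,
      Finset.sum_neg_distrib, ← Finset.mul_sum]
    refine ENNReal.ofReal_le_ofReal (Real.exp_le_exp.2 (neg_le_neg ?_))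
    refine mul_le_mul_of_nonneg_left ?_ hp
    have hlt := hs.lt_width_mul_sum hε0 hx
    -- At width zero the quotient is `0` by convention and the claimed factor is the trivial `1`.
    rcases (Nat.cast_nonneg (α := ℝ) w.width).eq_or_lt with hw | hw
    · rw [← hw, div_zero]
      exact Finset.sum_nonneg fun e _ => hx0 e
    · rw [div_le_iff₀ hw, mul_comm (∑ e ∈ _, _)]
      exact hlt.le
  calc _ ≤ ∑' c : E → ℕ, ∑' q : E → Bool, ∏ e, F e (c e) (q e) :=
        ENNReal.tsum_le_tsum fun c => ENNReal.tsum_le_tsum fun q => hterm c q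
    _ = ∏ e, ∑' a, ∑ b, F e a b := by
        rw [← tsum_prod_eq_prod_tsum _ fun e a => ENNReal.sum_ne_top.2 fun b _ => hFtop e a b]
        refine tsum_congr fun c => ?_
        rw [tsum_prod_eq_prod_tsum (fun e b => F e (c e) b) fun e b => hFtop e _ b]
        exact Finset.prod_congr rfl fun e _ => tsum_fintype _
    _ ≤ ∏ e, ((if e ∈ critical M w u h then ENNReal.ofReal (Real.exp (-(p * x e))) else 1) *
        ∑' a, w.law e a * (if h.Compatible e a then 1 else 0)) :=
        Finset.prod_le_prod' fun e _ => hfactor e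
    _ = (∏ e, if e ∈ critical M w u h then ENNReal.ofReal (Real.exp (-(p * x e))) else 1) *
        ∑' c, w.jointLaw c *
          (if (∀ e, h.Compatible e (c e)) ∧ Surviving M w ε u h then 1 else 0) := by
        rw [Finset.prod_mul_distrib, ← tsum_prod_eq_prod_tsum]
        · congr 1
          refine tsum_congr fun c => ?_
          rw [Finset.prod_mul_distrib, Fintype.prod_ite_zero]
          simp only [hs, and_true, Finset.prod_const_one]
          rfl
        · intro e a
          refine ENNReal.mul_ne_top (PMF.apply_ne_top _ _) ?_
          split_ifs <;> simp
    _ ≤ _ := by gcongr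

/-- The probability that the dual solution given by `u` survives `t` iterations. -/
noncomputable def survivalProb (alg : AdaptiveStrategy (matroidSystem M) w) (ε : ℝ) (u : E → ℕ)
    (t : ℕ) : ℝ≥0∞ :=
  ∑' c, w.jointLaw c * (alg.run c t).toOuterMeasure {h | Surviving M w ε u h}

theorem survivalProb_le_one (alg : AdaptiveStrategy (matroidSystem M) w) (t : ℕ) :
    survivalProb alg ε u t ≤ 1 := by
  rw [← w.jointLaw.tsum_coe]
  refine ENNReal.tsum_le_tsum fun c => mul_le_of_le_one_right (zero_le) ?_
  rw [← (alg.run c t).tsum_coe, PMF.toOuterMeasure_apply]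
  exact ENNReal.tsum_le_tsum fun h => Set.indicator_le_self _ _ _

open Classical in
theorem survivalProb_eq (alg : AdaptiveStrategy (matroidSystem M) w) (t : ℕ) :
    survivalProb alg ε u t = ∑' c, w.jointLaw c * ∑' h, alg.run c t h *
      (if Surviving M w ε u h then 1 else 0) := by
  unfold survivalProb
  simp only [PMF.toOuterMeasure_apply, Set.indicator_apply, Set.mem_ofPred_eq, mul_ite, mul_one,
    mul_zero]

open Classical in
theorem survivalProb_succ_eq (alg : AdaptiveStrategy (matroidSystem M) w) (t : ℕ) :
    survivalProb alg ε u (t + 1) = ∑' c, w.jointLaw c * ∑' h, alg.run c t h *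
      ∑' x, alg.solve h x * ∑' q : E → Bool, (indepLaw fun e => coin (x e)) q *
        (if Surviving M w ε u (h ++ [observe c q]) then 1 else 0) := by
  unfold survivalProb
  simp only [AdaptiveStrategy.run, AdaptiveStrategy.step, PMF.toOuterMeasure_bind_apply,
    PMF.toOuterMeasure_pure_apply, Set.mem_ofPred_eq]

/-- Deferred decisions: with the history as outermost sum, its `c`-free kernel factors out. What
remains is the product law restricted to compatible weights, where the one-step bound applies. -/
theorem survivalProb_succ_le (hM : M.E = Set.univ) (hp : 0 ≤ p)
    (hlaw : ∀ e, ENNReal.ofReal p ≤ w.law e (w.hi e)) (hε0 : 0 < ε) (hε1 : ε < 1)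
    (alg : AdaptiveStrategy (matroidSystem M) w) (t : ℕ) :
    survivalProb alg ε u (t + 1) ≤
      ENNReal.ofReal (Real.exp (-(p * (ε * (∑ e, (u e : ℝ) + 1) / w.width)))) *
        survivalProb alg ε u t := by
  classical
  obtain ⟨K, hK⟩ := alg.exists_run_eq t
  set ρ := ENNReal.ofReal (Real.exp (-(p * (ε * (∑ e, (u e : ℝ) + 1) / w.width))))
  have hL : survivalProb alg ε u (t + 1) = ∑' h, K h * ∑' x, alg.solve h x *
      ∑' c, ∑' q : E → Bool, w.jointLaw c * (indepLaw fun e => coin (x e)) q *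
        (if (∀ e, h.Compatible e (c e)) ∧ Surviving M w ε u (h ++ [observe c q])
          then 1 else 0) := by
    rw [survivalProb_succ_eq]
    simp only [← ENNReal.tsum_mul_left]
    rw [ENNReal.tsum_comm]
    refine tsum_congr fun h => ?_
    rw [ENNReal.tsum_comm]
    refine tsum_congr fun x => tsum_congr fun c => tsum_congr fun q => ?_
    rw [hK]
    by_cases hc : ∀ e, h.Compatible e (c e)
    · simp only [hc, implies_true, true_and, if_true]
      ring
    · simp [hc]
  have hR : survivalProb alg ε u t = ∑' h, K h * ∑' c, w.jointLaw c *
      (if (∀ e, h.Compatible e (c e)) ∧ Surviving M w ε u h then 1 else 0) := by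
    rw [survivalProb_eq]
    simp only [← ENNReal.tsum_mul_left]
    rw [ENNReal.tsum_comm]
    refine tsum_congr fun h => tsum_congr fun c => ?_
    rw [hK]
    by_cases hc : ∀ e, h.Compatible e (c e)
    · simp only [hc, implies_true, true_and, if_true]
      ring
    · simp [hc]
  rw [hL, hR, ← ENNReal.tsum_mul_left]
  refine ENNReal.tsum_le_tsum fun h => ?_
  rw [mul_left_comm]
  refine mul_le_mul_right ?_ _
  set B := ∑' c, w.jointLaw c *
      (if (∀ e, h.Compatible e (c e)) ∧ Surviving M w ε u h then 1 else 0)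
  calc _ ≤ ∑' x, alg.solve h x * (ρ * B) := by
        refine ENNReal.tsum_le_tsum fun x => ?_
        by_cases hx : alg.solve h x = 0
        · simp [hx]
        · refine mul_le_mul_right ?_ _
          exact tsum_surviving_append_le hM hp hlaw hε0 hε1
            (alg.solve_optimal h x ((PMF.mem_support_iff _ _).2 hx))
    _ = ρ * B := by rw [ENNReal.tsum_mul_right, PMF.tsum_coe, one_mul]

theorem survivalProb_le (hM : M.E = Set.univ) (hp : 0 ≤ p)
    (hlaw : ∀ e, ENNReal.ofReal p ≤ w.law e (w.hi e)) (hε0 : 0 < ε) (hε1 : ε < 1)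
    (alg : AdaptiveStrategy (matroidSystem M) w) (t : ℕ) :
    survivalProb alg ε u t ≤
      ENNReal.ofReal (Real.exp (-(p * (ε * (∑ e, (u e : ℝ) + 1) / w.width)))) ^ t := by
  induction t with
  | zero => simpa using survivalProb_le_one alg 0
  | succ t ih =>
    rw [pow_succ']
    exact (survivalProb_succ_le hM hp hlaw hε0 hε1 alg t).trans (mul_le_mul_right ih _)

theorem survivalProb_eq_zero_of_width_eq_zero (hε : 0 < ε) (hw : w.width = 0)
    (alg : AdaptiveStrategy (matroidSystem M) w) (t : ℕ) : survivalProb alg ε u t = 0 := by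
  have : {h | Surviving M w ε u h} = ∅ := by
    refine Set.eq_empty_of_forall_notMem fun h hs => ?_
    -- The support of `solve` supplies an LP optimum, against which the strict gap is impossible at
    -- width zero.
    obtain ⟨x, hx⟩ := (alg.solve h).support_nonempty
    have h1 := Surviving.lt_width_mul_sum hε hs (alg.solve_optimal h x hx)
    rw [hw, Nat.cast_zero, zero_mul] at h1
    have : 0 ≤ ∑ e, (u e : ℝ) := Finset.sum_nonneg fun _ _ => by positivity
    have := mul_pos hε (by linarith : 0 < ∑ e, (u e : ℝ) + 1)
    linarith
  unfold survivalProb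
  simp [this]

theorem survivalProb_eq_zero_of_subsingleton [Subsingleton E] (hε : 0 < ε)
    (alg : AdaptiveStrategy (matroidSystem M) w) (t : ℕ) : survivalProb alg ε u (t + 1) = 0 := by
  classical
  rw [survivalProb_succ_eq, ENNReal.tsum_eq_zero]
  intro c
  by_cases hc : w.jointLaw c = 0
  · simp [hc]
  refine mul_eq_zero_of_right _ (ENNReal.tsum_eq_zero.2 fun h => mul_eq_zero_of_right _
    (ENNReal.tsum_eq_zero.2 fun x => ?_))
  by_cases hx : alg.solve h x = 0
  · simp [hx]
  refine mul_eq_zero_of_right _ (ENNReal.tsum_eq_zero.2 fun q => ?_)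
  by_cases hq : (indepLaw fun e => coin (x e)) q = 0
  · simp [hq]
  rw [if_neg, mul_zero]
  refine not_surviving_of_subsingleton hε (StochasticWeight.lo_le_and_le_hi hc).2
    (alg.solve_optimal h x ((PMF.mem_support_iff _ _).2 hx)) fun e he => ?_
  by_contra hqe
  refine hq (Finset.prod_eq_zero (Finset.mem_univ e) ?_)
  rw [Bool.not_eq_true] at hqe
  rw [hqe, coin_false_of_one_le he]

/-- The union bound over all dual solutions. -/
theorem outcome_failure_le (hM : M.E = Set.univ) (hε1 : ε < 1)
    (alg : AdaptiveStrategy (matroidSystem M) w)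
    (hfin : ∀ h, ∀ S ∈ (alg.finish h).support,
      (matroidSystem M).IPOptimal (w.pessimistic h) S) (T : ℕ) :
    (alg.outcome T).toOuterMeasure
        {o | M.Indep (o.2 : Set E) ∧ ∀ J : Finset E, M.Indep (J : Set E) →
          (1 - ε) * ∑ e ∈ J, (o.1 e : ℝ) ≤ ∑ e ∈ o.2, (o.1 e : ℝ)}ᶜ
      ≤ ∑' u : E → ℕ, survivalProb alg ε u T := by
  classical
  set good : Set ((E → ℕ) × Finset E) := {o | M.Indep (o.2 : Set E) ∧
    ∀ J : Finset E, M.Indep (J : Set E) →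
      (1 - ε) * ∑ e ∈ J, (o.1 e : ℝ) ≤ ∑ e ∈ o.2, (o.1 e : ℝ)} with hgood
  obtain ⟨K, hK⟩ := alg.exists_run_eq T
  have hout : (alg.outcome T).toOuterMeasure goodᶜ = ∑' c, w.jointLaw c * ∑' h, alg.run c T h *
      ∑' S, alg.finish h S * (if (c, S) ∈ goodᶜ then 1 else 0) := by
    simp only [AdaptiveStrategy.outcome, PMF.toOuterMeasure_bind_apply,
      PMF.toOuterMeasure_pure_apply]
    congr!
  have hsum : ∑' u : E → ℕ, survivalProb alg ε u T = ∑' c, w.jointLaw c * ∑' h, alg.run c T h *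
      ∑' u : E → ℕ, (if Surviving M w ε u h then 1 else 0) := by
    simp only [survivalProb_eq, ← ENNReal.tsum_mul_left]
    rw [ENNReal.tsum_comm]
    exact tsum_congr fun c => ENNReal.tsum_comm
  rw [hout, hsum]
  refine ENNReal.tsum_le_tsum fun c => ?_
  by_cases hc : w.jointLaw c = 0
  · simp [hc]
  obtain ⟨hlo, hhi⟩ := StochasticWeight.lo_le_and_le_hi hc
  refine mul_le_mul_right (ENNReal.tsum_le_tsum fun h => ?_) _
  by_cases hcomp : ∀ e, h.Compatible e (c e)
  swap
  · simp [hK, hcomp]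
  refine mul_le_mul_right ?_ _
  set B := ∑' u : E → ℕ, (if Surviving M w ε u h then 1 else 0 : ℝ≥0∞)
  calc _ ≤ ∑' S, alg.finish h S * B := by
        refine ENNReal.tsum_le_tsum fun S => ?_
        by_cases hS : alg.finish h S = 0
        · simp [hS]
        refine mul_le_mul_right ?_ _
        have hopt := hfin h S ((PMF.mem_support_iff _ _).2 hS)
        split_ifs with hbad
        · have hex : ∃ J : Finset E, M.Indep (J : Set E) ∧
              ∑ e ∈ S, (c e : ℝ) < (1 - ε) * ∑ e ∈ J, (c e : ℝ) := by
            by_contra! hcon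
            exact hbad ⟨matroidSystem_ipFeasible_iff.1 hopt.1, hcon⟩
          obtain ⟨J, hJ, hlt⟩ := hex
          have hs := surviving_of_failure hM hε1 hlo hhi hcomp hopt hJ hlt
          -- The union bound: the single term of the dual solution read off from `S` already
          -- contributes `1`.
          refine le_trans ?_ (ENNReal.le_tsum fun i => if i ∈ S then w.pessimistic h i else 0)
          rw [if_pos hs]
        · exact zero_le
    _ = B := by rw [ENNReal.tsum_mul_right, PMF.tsum_coe, one_mul]

end Survival

/-! ## The union bound -/

theorem tsum_pow_sum_add_one {E : Type*} [Fintype E] {a : ℝ≥0∞} (ha : a ≠ ∞) :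
    ∑' u : E → ℕ, a ^ (∑ e, u e + 1) = a * (1 - a)⁻¹ ^ Fintype.card E := by
  have h := tsum_prod_eq_prod_tsum (fun (_ : E) (k : ℕ) => a ^ k) fun _ _ => ENNReal.pow_ne_top ha
  simp only [ENNReal.tsum_geometric, Finset.prod_const, Finset.card_univ] at h
  rw [← h, ← ENNReal.tsum_mul_left]
  exact tsum_congr fun u => by rw [pow_succ', Finset.prod_pow_eq_pow_sum]

theorem sq_div_mul_inv_pow_le {ε : ℝ} (hε0 : 0 < ε) (hε1 : ε < 1) {m : ℕ} (hm : 2 ≤ m) :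
    (ε / m) ^ 2 * (1 - (ε / m) ^ 2)⁻¹ ^ m ≤ ε := by
  have hm' : (2 : ℝ) ≤ m := by exact_mod_cast hm
  have hm0 : (0 : ℝ) < m := by linarith
  set b := ε / m with hb
  have hb0 : 0 < b := div_pos hε0 hm0
  have hmb : m * b = ε := by rw [hb]; field_simp
  have hb1 : b < 1 / 2 := by nlinarith
  have hpos : 0 < 1 - b ^ 2 := by nlinarith
  -- Bernoulli gives `(1 - b ^ 2) ^ m ≥ 1 - ε b ≥ 1 / 2`, while `b ^ 2 ≤ ε / 2`.
  have hbern := one_add_mul_le_pow (a := -b ^ 2) (by nlinarith) m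
  rw [← sub_eq_add_neg] at hbern
  have h1 : (m : ℝ) * b ^ 2 = ε * b := by rw [← hmb]; ring
  rw [inv_pow, ← div_eq_mul_inv, div_le_iff₀ (pow_pos hpos m)]
  have h2 : 1 / 2 ≤ (1 - b ^ 2) ^ m := by nlinarith
  nlinarith

/-- The choice of `T` makes `T ε p / W` at least `2 log (m / ε)`; the constant `2` becomes the
square. -/
theorem exp_pow_le_sq_pow {ε p W m : ℝ} (hε0 : 0 < ε) (hp : 0 < p) (hW : 0 < W) (hm : 0 < m)
    {T : ℕ} (hT : 2 * (W * Real.log (m / ε) / (ε * p)) ≤ T) (s : ℕ) :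
    Real.exp (-(p * (ε * (s + 1) / W))) ^ T ≤ ((ε / m) ^ 2) ^ (s + 1) := by
  have hlog : (ε / m) = Real.exp (-Real.log (m / ε)) := by
    rw [Real.exp_neg, Real.exp_log (div_pos hm hε0), inv_div]
  rw [hlog, ← Real.exp_nat_mul, ← Real.exp_nat_mul, ← Real.exp_nat_mul]
  refine Real.exp_le_exp.2 ?_
  have h1 : 2 * Real.log (m / ε) ≤ T * (ε * p / W) := by
    have := mul_le_mul_of_nonneg_right hT (by positivity : 0 ≤ ε * p / W)
    refine le_of_eq_of_le ?_ this
    field_simp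
  have h2 := mul_le_mul_of_nonneg_right h1 (by positivity : (0 : ℝ) ≤ s + 1)
  have h3 : (T : ℝ) * -(p * (ε * (s + 1) / W)) = -(T * (ε * p / W) * (s + 1)) := by ring
  rw [h3]
  push_cast
  linarith

theorem tsum_survivalProb_le {E : Type*} [Fintype E] [DecidableEq E] [Nonempty E] {M : Matroid E}
    (hM : M.E = Set.univ) {w : StochasticWeight E} {p : ℝ} (hp : 0 < p)
    (hlaw : ∀ e, ENNReal.ofReal p ≤ w.law e (w.hi e)) {ε : ℝ} (hε0 : 0 < ε) (hε1 : ε < 1)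
    (alg : AdaptiveStrategy (matroidSystem M) w) {T : ℕ}
    (hT : 2 * ((w.width : ℝ) * Real.log ((Fintype.card E : ℝ) / ε) / (ε * p)) ≤ (T : ℝ)) :
    ∑' u : E → ℕ, survivalProb alg ε u T ≤ ENNReal.ofReal ε := by
  rcases Nat.eq_zero_or_pos w.width with hw | hw
  · simp [survivalProb_eq_zero_of_width_eq_zero hε0 hw]
  have hw' : (0 : ℝ) < w.width := by exact_mod_cast hw
  have hm1 : (1 : ℝ) ≤ Fintype.card E := by exact_mod_cast Fintype.card_pos (α := E)
  -- For `m = 1` the geometric bound `ε ^ 2 / (1 - ε ^ 2) ≤ ε` fails for `ε` near `1`, but `T ≥ 1`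
  -- and one iteration suffices.
  rcases subsingleton_or_nontrivial E with hE | hE
  · have hlog : 0 < Real.log ((Fintype.card E : ℝ) / ε) :=
      Real.log_pos ((one_lt_div hε0).2 (hε1.trans_le hm1))
    have hTpos : (0 : ℝ) < T := lt_of_lt_of_le (by positivity) hT
    have hT0 : T ≠ 0 := by exact_mod_cast hTpos.ne'
    obtain ⟨t, rfl⟩ := Nat.exists_eq_succ_of_ne_zero hT0
    simp [survivalProb_eq_zero_of_subsingleton hε0]
  have hm : 2 ≤ Fintype.card E := Fintype.one_lt_card
  set a : ℝ := (ε / Fintype.card E) ^ 2 with ha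
  have ha0 : 0 ≤ a := sq_nonneg _
  have ha1 : a < 1 := by
    have : ε / Fintype.card E < 1 := (div_lt_one (by linarith)).2 (hε1.trans_le hm1)
    exact pow_lt_one₀ (by positivity) this two_ne_zero
  calc ∑' u : E → ℕ, survivalProb alg ε u T
      ≤ ∑' u : E → ℕ, ENNReal.ofReal a ^ (∑ e, u e + 1) := by
        refine ENNReal.tsum_le_tsum fun u =>
          (survivalProb_le hM hp.le hlaw hε0 hε1 alg T).trans ?_
        rw [← ENNReal.ofReal_pow (Real.exp_pos _).le, ← ENNReal.ofReal_pow ha0]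
        refine ENNReal.ofReal_le_ofReal ?_
        have := exp_pow_le_sq_pow hε0 hp hw' (by linarith) hT (∑ e, u e)
        push_cast at this
        exact this
    _ = ENNReal.ofReal (a * (1 - a)⁻¹ ^ Fintype.card E) := by
        rw [tsum_pow_sum_add_one ENNReal.ofReal_ne_top, ENNReal.ofReal_mul ha0,
          ENNReal.ofReal_pow (inv_nonneg.2 (by linarith)),
          ENNReal.ofReal_inv_of_pos (by linarith), ENNReal.ofReal_sub _ ha0, ENNReal.ofReal_one]
    _ ≤ ENNReal.ofReal ε := ENNReal.ofReal_le_ofReal (sq_div_mul_inv_pow_le hε0 hε1 hm)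

theorem toOuterMeasure_add_compl {α : Type*} (P : PMF α) (s : Set α) :
    P.toOuterMeasure s + P.toOuterMeasure sᶜ = 1 := by
  rw [PMF.toOuterMeasure_apply, PMF.toOuterMeasure_apply, ← ENNReal.tsum_add, ← P.tsum_coe]
  exact tsum_congr fun x => Set.indicator_self_add_compl_apply s P x

end StochasticPacking

theorem mainTheorem8 :
    ∃ C : ℝ, 0 < C ∧
      ∀ (E : Type*) [Fintype E] [DecidableEq E] [Nonempty E]
        (M : Matroid E) (_ : M.E = Set.univ)
        (w : StochasticPacking.StochasticWeight E)
        (p : ℝ) (_ : 0 < p) (_ : p ≤ 1)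
        (_ : ∀ e, ENNReal.ofReal p ≤ w.law e (w.hi e))
        (ε : ℝ) (_ : 0 < ε) (_ : ε < 1)
        (alg : StochasticPacking.AdaptiveStrategy (StochasticPacking.matroidSystem M) w)
        (_ : ∀ h, ∀ S ∈ (alg.finish h).support,
          (StochasticPacking.matroidSystem M).IPOptimal (w.pessimistic h) S)
        (T : ℕ)
        (_ : C * ((w.width : ℝ) * Real.log ((Fintype.card E : ℝ) / ε) / (ε * p)) ≤ (T : ℝ)),
        ENNReal.ofReal (1 - ε) ≤
          (alg.outcome T).toOuterMeasure
            {o | M.Indep (o.2 : Set E) ∧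
              ∀ J : Finset E, M.Indep (J : Set E) →
                (1 - ε) * ∑ e ∈ J, (o.1 e : ℝ) ≤ ∑ e ∈ o.2, (o.1 e : ℝ)} := by
  -- With constant `1` the series ratio would be `ε / m`, too large for this union bound when `m =
  -- 2` and `ε` is near `1`; its square suffices.
  refine ⟨2, two_pos, ?_⟩
  intro E _ _ _ M hM w p hp _ hlaw ε hε0 hε1 alg hfin T hT
  have hfail := (StochasticPacking.outcome_failure_le hM hε1 alg hfin T).trans
    (StochasticPacking.tsum_survivalProb_le hM hp hlaw hε0 hε1 alg hT)
  rw [ENNReal.ofReal_sub _ hε0.le, ENNReal.ofReal_one,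
    ← StochasticPacking.toOuterMeasure_add_compl (alg.outcome T)
      {o | M.Indep (o.2 : Set E) ∧ ∀ J : Finset E, M.Indep (J : Set E) →
        (1 - ε) * ∑ e ∈ J, (o.1 e : ℝ) ≤ ∑ e ∈ o.2, (o.1 e : ℝ)}]
  exact tsub_le_iff_right.2 (add_le_add_right hfail _)
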